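/- **Terminology.** A $\lambda$-ring is a commutative ring $R$ with operations $\lambda^n$ ($n\ge 0$) satisfying $\lambda^0(x)=1$, $\lambda^1(x)=x$, $\lambda^n(x+y)=\sum_{i+j=n}\lambda^i(x)\lambda^j(y)$, $\lambda^n(1)=0$ for $n\ge 2$, and the formulas for $\lambda^n(xy)$ and $\lambda^m(\lambda^n(x))$ given by the universal integer polynomials $P_n$ and $P_{m,n}$ (a "special $\lambda$-ring" in older terminology); homomorphisms of $\lambda$-rings are the ring homomorphisms commuting with all $\lambda^n$. An element $\ell$ is a *line element* if $\lambda^n(\ell)=0$ for all $n>1$. For a partition $\pi$, let $s_\pi(x)=\det\big(\lambda^{\pi'_i+j-i}(x)\big)_{i,j}$ be the value at $x$ of the Schur polynomial $s_\pi$ (here $\pi'$ is the conjugate partition, and $\lambda^k=0$ for $k<0$). An element $x$ is *Schur-finite* if there is a partition $\kappa$ with $s_\pi(x)=0$ for every partition $\pi$ whose Young diagram contains that of $\kappa$. For a commutative ring $A$, the *big Witt ring* $W(A)$ is the $\lambda$-ring with underlying set $1+tA[[t]]$, whose addition is multiplication of power series and whose multiplication and operations $\lambda^n$ are given coefficientwise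 by the universal polynomials, so that $(1+at)*(1+bt)=1+abt$; products of $\lambda$-rings carry the componentwise structure. **Corollary** (the virtual splitting principle holds for reduced $\lambda$-rings). Let $R$ be a $\lambda$-ring whose underlying ring is reduced. Then there are a family $(E_i)_{i\in I}$ of algebraically closed fields and an injective homomorphism of $\lambda$-rings $\varphi\colon R\hookrightarrow R'=\prod_{i\in I}W(E_i)$ such that for every Schur-finite element $x\in R$ there are finitely many line elements $\ell_1,\dots,\ell_m,\ell'_1,\dots,\ell'_n$ of $R'$ with $$\varphi(x)=\sum_{a=1}^m\ell_a-\sum_{b=1}^n\ell'_b .$$ -/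

import Mathlib

universe u

noncomputable section

namespace SymmPoly

open MvPolynomial

section Multisets

variable {A B : Type*} [CommRing A] [CommRing B]

/-- The multiset of all products `a * b` with `a` in `s` and `b` in `t`. -/
def mprod (s t : Multiset A) : Multiset A :=
  s.bind fun a => t.map fun b => a * b

/-- The multiset of all products of `n` entries of `s` (at distinct positions). -/
def mwedge (n : ℕ) (s : Multiset A) : Multiset A :=
  (s.powersetCard n).map Multiset.prod

/-- The power sum of the entries of `s`. -/
def mpow (k : ℕ) (s : Multiset A) : A := (s.map (· ^ k)).sum

theorem esymm_eq_sum_mwedge (s : Multiset A) (n : ℕ) : s.esymm n = (mwedge n s).sum := rfl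

theorem map_mprod {F : Type*} [FunLike F A B] [RingHomClass F A B] (f : F) (s t : Multiset A) :
    (mprod s t).map f = mprod (s.map f) (t.map f) := by
  simp [mprod, Multiset.map_bind, Multiset.bind_map]

theorem map_mwedge {F : Type*} [FunLike F A B] [RingHomClass F A B] (f : F) (n : ℕ)
    (s : Multiset A) : (mwedge n s).map f = mwedge n (s.map f) := by
  simp [mwedge, Multiset.powersetCard_map, map_multiset_prod]

theorem map_esymm' {F : Type*} [FunLike F A B] [RingHomClass F A B] (f : F) (n : ℕ)
    (s : Multiset A) : f (s.esymm n) = (s.map f).esymm n := by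
  rw [esymm_eq_sum_mwedge, esymm_eq_sum_mwedge, map_multiset_sum, map_mwedge]

theorem aeval_ringHom {F σ : Type*} [FunLike F A B] [RingHomClass F A B] (f : F) (g : σ → A)
    (P : MvPolynomial σ ℤ) : f (aeval g P) = aeval (fun i => f (g i)) P := by
  induction P using MvPolynomial.induction_on with
  | C a => simp
  | add p q hp hq => simp [hp, hq]
  | mul_X p i hp => simp [hp]

@[simp] theorem esymm_zero' (s : Multiset A) : s.esymm 0 = 1 := by
  simp [Multiset.esymm]

theorem esymm_cons_succ (a : A) (s : Multiset A) (n : ℕ) :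
    (a ::ₘ s).esymm (n + 1) = s.esymm (n + 1) + a * s.esymm n := by
  simp only [Multiset.esymm, Multiset.powersetCard_cons, Multiset.map_add, Multiset.sum_add,
    Multiset.map_map, Function.comp_def, Multiset.prod_cons, Multiset.sum_map_mul_left]

/-- The power series `∏ (1 + a t)`, `a` running over `s`. -/
def mser (s : Multiset A) : PowerSeries A :=
  (s.map fun a => 1 + PowerSeries.C a * PowerSeries.X).prod

theorem coeff_mser (s : Multiset A) (n : ℕ) : PowerSeries.coeff n (mser s) = s.esymm n := by
  induction s using Multiset.induction_on generalizing n with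
  | empty =>
    cases n with
    | zero => simp [mser]
    | succ n => simp [mser, Multiset.esymm, Multiset.powersetCard_zero_right, PowerSeries.coeff_one]
  | cons a s ih =>
    have h : mser (a ::ₘ s) = mser s + PowerSeries.C a * (mser s * PowerSeries.X) := by
      simp [mser]; ring
    cases n with
    | zero =>
      have h0 := ih 0
      simp only [PowerSeries.coeff_zero_eq_constantCoeff, esymm_zero'] at h0
      simp [h, h0]
    | succ n => rw [h, esymm_cons_succ]; simp [ih, PowerSeries.coeff_succ_mul_X]

theorem mser_add (s t : Multiset A) : mser (s + t) = mser s * mser t := by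
  simp [mser]

theorem esymm_add (s t : Multiset A) (n : ℕ) :
    (s + t).esymm n = ∑ p ∈ Finset.HasAntidiagonal.antidiagonal n, s.esymm p.1 * t.esymm p.2 := by
  simp only [← coeff_mser, mser_add, PowerSeries.coeff_mul]

theorem mprod_comm (s t : Multiset A) : mprod s t = mprod t s := by
  unfold mprod
  rw [Multiset.bind_map_comm]
  simp only [mul_comm]

theorem mprod_assoc (s t u : Multiset A) : mprod (mprod s t) u = mprod s (mprod t u) := by
  unfold mprod
  rw [Multiset.bind_assoc]
  simp only [Multiset.bind_map, Multiset.map_bind, Multiset.map_map, Function.comp_def, mul_assoc]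

theorem mprod_add (s t u : Multiset A) : mprod s (t + u) = mprod s t + mprod s u := by
  simp [mprod, Multiset.bind_add]

theorem one_mprod (s : Multiset A) : mprod {1} s = s := by
  simp [mprod]

theorem mpow_mprod (k : ℕ) (s t : Multiset A) : mpow k (mprod s t) = mpow k s * mpow k t := by
  induction s using Multiset.induction_on with
  | empty => simp [mprod, mpow]
  | cons a s ih =>
    have h : mprod (a ::ₘ s) t = t.map (fun b => a * b) + mprod s t := by simp [mprod]
    rw [h]
    simp only [mpow, Multiset.map_add, Multiset.sum_add, Multiset.map_cons, Multiset.sum_cons,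
      add_mul] at ih ⊢
    rw [ih]
    simp [mul_pow, Multiset.sum_map_mul_left]

theorem mpow_mwedge (k n : ℕ) (s : Multiset A) :
    mpow k (mwedge n s) = (s.map (· ^ k)).esymm n := by
  simp only [mpow, mwedge, Multiset.esymm, Multiset.powersetCard_map, Multiset.map_map,
    Function.comp_def, Multiset.prod_map_pow, Multiset.map_id']

theorem mpow_map_pow (j k : ℕ) (s : Multiset A) :
    mpow j (s.map (· ^ k)) = mpow (k * j) s := by
  simp [mpow, pow_mul]

theorem multiset_eq_map_fin {A : Type*} (s : Multiset A) (n : ℕ) (hn : s.card = n) :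
    ∃ f : Fin n → A, s = Finset.univ.val.map f := by
  subst hn
  refine ⟨fun i => s.toList.get (i.cast (by simp)), ?_⟩
  have h : ∀ (l : List A) (n : ℕ) (h : n = l.length),
      (l : Multiset A) = (Finset.univ : Finset (Fin n)).val.map fun i => l.get (i.cast h) := by
    rintro l n rfl
    simp
  conv_lhs => rw [← s.coe_toList]
  exact h _ _ _

theorem newton_esymm (s : Multiset A) (k : ℕ) :
    (k : A) * s.esymm k = (-1) ^ (k + 1) *
      ∑ a ∈ Finset.HasAntidiagonal.antidiagonal k with a.1 < k, (-1) ^ a.1 * s.esymm a.1 * mpow a.2 s := by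
  obtain ⟨f, hf⟩ := multiset_eq_map_fin s _ rfl
  have h := congrArg (aeval (R := ℤ) f) (mul_esymm_eq_sum (Fin s.card) ℤ k)
  simp only [map_mul, map_natCast, map_pow, map_neg, map_one, map_sum,
    aeval_esymm_eq_multiset_esymm, ← hf, psum, aeval_X] at h
  rw [h]
  congr 1
  refine Finset.sum_congr rfl fun a _ => ?_
  congr 1
  unfold mpow
  conv_rhs => rw [hf]
  rw [Multiset.map_map]
  rfl

theorem newton_psum (s : Multiset A) (k : ℕ) (hk : 0 < k) :
    mpow k s = (-1) ^ (k + 1) * k * s.esymm k -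
      ∑ a ∈ Finset.HasAntidiagonal.antidiagonal k with a.1 ∈ Set.Ioo 0 k,
        (-1) ^ a.1 * s.esymm a.1 * mpow a.2 s := by
  obtain ⟨f, hf⟩ := multiset_eq_map_fin s _ rfl
  have h := congrArg (aeval (R := ℤ) f) (psum_eq_mul_esymm_sub_sum (Fin s.card) ℤ k hk)
  have e : ∀ j, mpow j s = ∑ i, f i ^ j := fun j => by
    unfold mpow
    conv_lhs => rw [hf]
    rw [Multiset.map_map]
    rfl
  simp only [map_mul, map_natCast, map_pow, map_neg, map_one, map_sum, map_sub,
    aeval_esymm_eq_multiset_esymm, ← hf, psum, aeval_X, ← e] at h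
  exact h

theorem esymm_eq_of_mpow_eq {K : Type*} [Field K] [CharZero K] {s t : Multiset K} {N : ℕ}
    (h : ∀ k, 0 < k → k ≤ N → mpow k s = mpow k t) (k : ℕ) (hk : k ≤ N) :
    s.esymm k = t.esymm k := by
  induction k using Nat.strong_induction_on with
  | _ k ih =>
    rcases Nat.eq_zero_or_pos k with rfl | hk0
    · simp
    have hk' : (k : K) ≠ 0 := by exact_mod_cast hk0.ne'
    apply mul_left_cancel₀ hk'
    rw [newton_esymm, newton_esymm]
    congr 1
    refine Finset.sum_congr rfl fun a ha => ?_
    simp only [Finset.mem_filter, Finset.HasAntidiagonal.mem_antidiagonal] at ha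
    rw [ih a.1 ha.2 (by omega), h a.2 (by omega) (by omega)]

theorem mpow_eq_of_esymm_eq {s t : Multiset A} {N : ℕ}
    (h : ∀ k, k ≤ N → s.esymm k = t.esymm k) (k : ℕ) (hk0 : 0 < k) (hk : k ≤ N) :
    mpow k s = mpow k t := by
  induction k using Nat.strong_induction_on with
  | _ k ih =>
    rw [newton_psum s k hk0, newton_psum t k hk0, h k hk]
    congr 1
    refine Finset.sum_congr rfl fun a ha => ?_
    simp only [Finset.mem_filter, Finset.HasAntidiagonal.mem_antidiagonal, Set.mem_Ioo] at ha
    rw [ih a.2 (by omega) (by omega) (by omega), h a.1 (by omega)]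

/-- Over an algebraically closed field the first `N` elementary symmetric functions of a
multiset of `N` elements can be prescribed. -/
theorem exists_multiset_esymm {K : Type*} [Field K] [IsAlgClosed K] (N : ℕ) (c : ℕ → K) :
    ∃ s : Multiset K, s.card = N ∧ ∀ k, 0 < k → k ≤ N → s.esymm k = c k := by
  open Polynomial in
  let p : K[X] := ∑ i : Fin N, Polynomial.C ((-1) ^ (N - (i : ℕ)) * c (N - i)) * Polynomial.X ^ (i : ℕ)
  let q := Polynomial.X ^ N + p
  have hp : p.degree < N := Polynomial.degree_sum_fin_lt _
  have hq : q.Monic := Polynomial.monic_X_pow_add hp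
  have hdeg : q.natDegree = N := Polynomial.natDegree_eq_of_degree_eq_some
    (by rw [Polynomial.degree_add_eq_left_of_degree_lt] <;> simp [hp])
  have hs : q.Splits := IsAlgClosed.splits q
  have hcard : q.roots.card = N := by rw [← hdeg]; exact hs.natDegree_eq_card_roots.symm
  refine ⟨q.roots, hcard, fun k hk0 hk => ?_⟩
  have h := Polynomial.coeff_eq_esymm_roots_of_card (hcard.trans hdeg.symm) (k := N - k)
    (by omega)
  rw [hq.leadingCoeff, hdeg, one_mul, show N - (N - k) = k by omega] at h
  have hc : q.coeff (N - k) = (-1) ^ k * c k := by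
    simp only [q, p, Polynomial.coeff_add, Polynomial.coeff_X_pow, Polynomial.finsetSum_coeff,
      Polynomial.coeff_C_mul]
    rw [if_neg (by omega), zero_add, Finset.sum_eq_single ⟨N - k, by omega⟩]
    · simp [show N - (N - k) = k by omega]
    · intro b _ hb
      rw [if_neg, mul_zero]
      intro h'
      exact hb (Fin.ext h'.symm)
    · simp
  rw [hc] at h
  have : ((-1 : K) ^ k) ≠ 0 := by simp
  exact (mul_left_cancel₀ this h).symm

end Multisets

section Universal

/-- The multiset of the variables `X_i`, `i ∈ σ`, of a polynomial ring. -/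
def vars (σ : Type*) [Fintype σ] {τ : Type*} (f : σ → τ) : Multiset (MvPolynomial τ ℤ) :=
  Finset.univ.val.map fun i => X (f i)

theorem isSymmetric_esymm_mwedge (m n N : ℕ) :
    ((mwedge n (vars (Fin N) id)).esymm m).IsSymmetric := by
  intro e
  rw [map_esymm', map_mwedge]
  congr 2
  simp only [vars, Multiset.map_map, Function.comp_def, rename_X, id]
  have : Finset.univ.val.map e = (Finset.univ : Finset (Fin N)).val := by
    rw [← Finset.map_univ_equiv e]; simp
  conv_rhs => rw [← this, Multiset.map_map]
  rfl

theorem exists_lamPoly (m n : ℕ) : ∃ P : MvPolynomial (Fin (m * n)) ℤ,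
    aeval (fun i : Fin (m * n) => (vars (Fin (m * n)) id).esymm (i + 1)) P =
      (mwedge n (vars (Fin (m * n)) id)).esymm m := by
  obtain ⟨P, hP⟩ := (esymmAlgHom_fin_bijective ℤ (m * n)).2
    ⟨_, isSymmetric_esymm_mwedge m n (m * n)⟩
  refine ⟨P, ?_⟩
  have h := congrArg Subtype.val hP
  rw [esymmAlgHom_apply] at h
  simp only [esymm_eq_multiset_esymm] at h
  exact h

/-- The series `g(z t)`, where `g = 1 + ∑ b_k t ^ k`. -/
def scaleSer {T : Type*} [CommRing T] (n : ℕ) (b : Fin n → T) (z : T) : PowerSeries T :=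
  1 + ∑ k : Fin n, PowerSeries.C (b k * z ^ ((k : ℕ) + 1)) * PowerSeries.X ^ ((k : ℕ) + 1)

theorem map_scaleSer {T U : Type*} [CommRing T] [CommRing U] (f : T →+* U) (n : ℕ) (b : Fin n → T)
    (z : T) : PowerSeries.map f (scaleSer n b z) = scaleSer n (fun k => f (b k)) (f z) := by
  simp [scaleSer]

theorem esymm_eq_zero {A : Type*} [CommRing A] (s : Multiset A) (k : ℕ) (h : s.card < k) :
    s.esymm k = 0 := by
  simp [Multiset.esymm, Multiset.powersetCard_eq_empty k h]

theorem mser_map_mul {T : Type*} [CommRing T] (s : Multiset T) (n : ℕ) (hs : s.card = n) (z : T) :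
    mser (s.map fun b => z * b) = scaleSer n (fun k => s.esymm (k + 1)) z := by
  ext m
  have h := Multiset.pow_smul_esymm z m s
  simp only [smul_eq_mul] at h
  rw [coeff_mser, ← h]
  simp only [scaleSer, map_add, map_sum, PowerSeries.coeff_C_mul, PowerSeries.coeff_X_pow,
    PowerSeries.coeff_one]
  cases m with
  | zero => simp
  | succ m =>
    by_cases hm : m < n
    · rw [Finset.sum_eq_single ⟨m, hm⟩]
      · simp [mul_comm]
      · intro b _ hb
        rw [if_neg, mul_zero]
        intro h'
        exact hb (Fin.ext (by simp; omega))
      · simp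
    · rw [esymm_eq_zero s _ (by omega), Finset.sum_eq_zero]
      · simp
      · intro b _
        rw [if_neg (by omega), mul_zero]

theorem prod_mser_map_mul {T : Type*} [CommRing T] (s t : Multiset T) :
    (s.map fun a => mser (t.map fun b => a * b)).prod = mser (mprod s t) := by
  induction s using Multiset.induction_on with
  | empty => simp [mprod, mser]
  | cons a s ih => simp only [mprod, Multiset.map_cons, Multiset.prod_cons, Multiset.cons_bind,
      mser_add] at ih ⊢; rw [ih]

theorem exists_mulPoly_aux (n : ℕ) : ∃ P : MvPolynomial (Fin n ⊕ Fin n) ℤ,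
    ∀ {T : Type} [CommRing T] (s t : Multiset T), s.card = n → t.card = n →
    aeval (Sum.elim (fun i : Fin n => s.esymm (i + 1)) (fun j : Fin n => t.esymm (j + 1))) P =
      (mprod s t).esymm n := by
  let S : MvPolynomial (Fin n) (MvPolynomial (Fin n) ℤ) :=
    PowerSeries.coeff n (∏ i : Fin n, scaleSer n (fun k => C (X k)) (X i))
  have hS : S.IsSymmetric := by
    intro e
    have h : ∀ F : PowerSeries (MvPolynomial (Fin n) (MvPolynomial (Fin n) ℤ)),
      rename e (PowerSeries.coeff n F) =
        PowerSeries.coeff n (PowerSeries.map (rename e).toRingHom F) := fun F => by simp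
    simp only [S]
    rw [h, map_prod]
    congr 1
    simp only [map_scaleSer]
    simp only [AlgHom.toRingHom_eq_coe, RingHom.coe_coe, rename_C, rename_X]
    exact Fintype.prod_equiv e _ _ (fun i => rfl)
  obtain ⟨P, hP⟩ := (esymmAlgHom_fin_bijective (MvPolynomial (Fin n) ℤ) n).2 ⟨S, hS⟩
  have hP' := congrArg Subtype.val hP
  rw [esymmAlgHom_apply] at hP'
  refine ⟨eval₂Hom (rename Sum.inr).toRingHom (fun i => X (Sum.inl i)) P, fun {T} _ s t hs ht => ?_⟩
  obtain ⟨f, hf⟩ := multiset_eq_map_fin s _ rfl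
  subst hs
  let θ : MvPolynomial (Fin s.card) ℤ →+* T := (aeval fun j : Fin s.card => t.esymm (j + 1)).toRingHom
  let Θ : MvPolynomial (Fin s.card) (MvPolynomial (Fin s.card) ℤ) →+* T := eval₂Hom θ f
  have h1 : Θ S = (mprod s t).esymm s.card := by
    simp only [S]
    rw [← PowerSeries.coeff_map, map_prod, ← coeff_mser, ← prod_mser_map_mul]
    congr 1
    simp only [map_scaleSer, mser_map_mul t s.card ht]
    have : ∀ k : Fin s.card, θ (X k) = t.esymm (k + 1) := fun k => by simp [θ]
    simp only [Θ, coe_eval₂Hom, eval₂_C, eval₂_X, this]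
    conv_rhs => 
      arg 1
      arg 2
      rw [hf]
    rw [Multiset.map_map]
    rfl
  have h2 : ∀ i, Θ (esymm _ _ i) = s.esymm i := fun i => by
    rw [esymm_eq_multiset_esymm, map_esymm', Multiset.map_map]
    conv_rhs => rw [hf]
    simp [Θ, Function.comp_def]
  have h3 : ∀ Q : MvPolynomial (Fin s.card) (MvPolynomial (Fin s.card) ℤ), Θ (aeval (fun i : Fin s.card => esymm (Fin s.card) _ (i + 1)) Q) =
      aeval (Sum.elim (fun i : Fin s.card => s.esymm (i + 1))
        (fun j : Fin s.card => t.esymm (j + 1)))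
        (eval₂Hom (rename Sum.inr).toRingHom (fun i => X (Sum.inl i)) Q) := by
    intro Q
    induction Q using MvPolynomial.induction_on with
    | C a =>
      simp only [aeval_C, algebraMap_eq, Θ, coe_eval₂Hom, eval₂_C, θ, AlgHom.toRingHom_eq_coe,
        RingHom.coe_coe, aeval_rename]
      rfl
    | add p q hp hq => rw [map_add, map_add, hp, hq, map_add, map_add]
    | mul_X p i hp =>
      rw [map_mul, map_mul, hp, map_mul, map_mul, aeval_X, h2]
      simp only [coe_eval₂Hom, eval₂_X, aeval_X, Sum.elim_inl]
  rw [← h1, ← h3]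
  exact congrArg Θ hP'

theorem exists_mulPoly (n : ℕ) : ∃ P : MvPolynomial (Fin n ⊕ Fin n) ℤ,
    aeval (Sum.elim (fun i : Fin n => (vars (Fin n) Sum.inl).esymm (i + 1))
      (fun j : Fin n => (vars (Fin n) Sum.inr).esymm (j + 1))) P =
      (mprod (vars (Fin n) (τ := Fin n ⊕ Fin n) Sum.inl) (vars (Fin n) Sum.inr)).esymm n := by
  obtain ⟨P, hP⟩ := exists_mulPoly_aux n
  exact ⟨P, hP _ _ (by simp [vars]) (by simp [vars])⟩

/-- The universal polynomial `P_n` in two groups of `n` variables, characterised by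
`P_n(e_1(x), …, e_n(x); e_1(y), …, e_n(y)) = e_n(x_i y_j : 1 ≤ i, j ≤ n)`. -/
def mulPoly (n : ℕ) : MvPolynomial (Fin n ⊕ Fin n) ℤ := (exists_mulPoly n).choose

/-- The universal polynomial `P_{m,n}` in `m n` variables, characterised by
`P_{m,n}(e_1(x), …, e_{mn}(x)) = e_m(x_{i_1} ⋯ x_{i_n} : i_1 < ⋯ < i_n)`. -/
def lamPoly (m n : ℕ) : MvPolynomial (Fin (m * n)) ℤ := (exists_lamPoly m n).choose

/-- The value of `P_n` at the first `n` terms of two sequences `a_1, a_2, …` and `b_1, b_2, …`. -/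
def mulEval {A : Type*} [CommRing A] (n : ℕ) (a b : ℕ → A) : A :=
  aeval (Sum.elim (fun i : Fin n => a (i + 1)) (fun j : Fin n => b (j + 1))) (mulPoly n)

/-- The value of `P_{m,n}` at the first `m n` terms of a sequence `a_1, a_2, …`. -/
def lamEval {A : Type*} [CommRing A] (m n : ℕ) (a : ℕ → A) : A :=
  aeval (fun i : Fin (m * n) => a (i + 1)) (lamPoly m n)

theorem map_mulEval {A B : Type*} [CommRing A] [CommRing B] (f : A →+* B) (n : ℕ) (a b : ℕ → A) :
    f (mulEval n a b) = mulEval n (fun i => f (a i)) (fun i => f (b i)) := by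
  unfold mulEval
  rw [aeval_ringHom]
  congr 2
  funext i
  cases i <;> rfl

theorem map_lamEval {A B : Type*} [CommRing A] [CommRing B] (f : A →+* B) (m n : ℕ) (a : ℕ → A) :
    f (lamEval m n a) = lamEval m n (fun i => f (a i)) := by
  unfold lamEval
  rw [aeval_ringHom]

theorem mulEval_congr {A : Type*} [CommRing A] {n : ℕ} {a b a' b' : ℕ → A}
    (h : ∀ k, 0 < k → k ≤ n → a k = a' k) (h' : ∀ k, 0 < k → k ≤ n → b k = b' k) :
    mulEval n a b = mulEval n a' b' := by
  unfold mulEval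
  congr 2
  funext i
  rcases i with i | i
  · exact h _ (by omega) (by omega)
  · exact h' _ (by omega) (by omega)

theorem lamEval_congr {A : Type*} [CommRing A] {m n : ℕ} {a a' : ℕ → A}
    (h : ∀ k, 0 < k → k ≤ m * n → a k = a' k) : lamEval m n a = lamEval m n a' := by
  unfold lamEval
  congr 2
  funext i
  exact h _ (by omega) (by omega)

theorem mulEval_of_card {T : Type*} [CommRing T] (n : ℕ) (s t : Multiset T) (hs : s.card = n)
    (ht : t.card = n) : mulEval n s.esymm t.esymm = (mprod s t).esymm n := by
  obtain ⟨f, hf⟩ := multiset_eq_map_fin s n hs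
  obtain ⟨g, hg⟩ := multiset_eq_map_fin t n ht
  let φ : MvPolynomial (Fin n ⊕ Fin n) ℤ →+* T := (aeval (Sum.elim f g)).toRingHom
  have h : mulEval n (vars (Fin n) (τ := Fin n ⊕ Fin n) Sum.inl).esymm
      (vars (Fin n) Sum.inr).esymm = _ := (exists_mulPoly n).choose_spec
  have h' := congrArg φ h
  have h1 : (vars (Fin n) (τ := Fin n ⊕ Fin n) Sum.inl).map φ = s := by
    simp only [vars, Multiset.map_map, hf, φ, Function.comp_def]; simp
  have h2 : (vars (Fin n) (τ := Fin n ⊕ Fin n) Sum.inr).map φ = t := by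
    simp only [vars, Multiset.map_map, hg, φ, Function.comp_def]; simp
  simpa only [map_mulEval, map_esymm', map_mprod, h1, h2] using h'

theorem lamEval_of_card {T : Type*} [CommRing T] (m n : ℕ) (s : Multiset T)
    (hs : s.card = m * n) : lamEval m n s.esymm = (mwedge n s).esymm m := by
  obtain ⟨f, hf⟩ := multiset_eq_map_fin s _ hs
  let φ : MvPolynomial (Fin (m * n)) ℤ →+* T := (aeval f).toRingHom
  have h : lamEval m n (vars (Fin (m * n)) id).esymm = _ := (exists_lamPoly m n).choose_spec
  have h' := congrArg φ h
  have h1 : (vars (Fin (m * n)) id).map φ = s := by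
    simp only [vars, Multiset.map_map, hf, φ, Function.comp_def]; simp
  simpa only [map_lamEval, map_esymm', map_mwedge, h1] using h'

/-- Every polynomial ring over `ℤ` embeds in an algebraically closed field of characteristic `0`. -/
theorem exists_embedding (σ : Type) : ∃ (K : Type) (_ : Field K) (_ : IsAlgClosed K)
    (_ : CharZero K) (ψ : MvPolynomial σ ℤ →+* K), Function.Injective ψ := by
  let F := FractionRing (MvPolynomial σ ℤ)
  have : CharZero F := charZero_of_injective_algebraMap
    (IsFractionRing.injective (MvPolynomial σ ℤ) F)
  have : CharZero (AlgebraicClosure F) := charZero_of_injective_algebraMap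
    (algebraMap F (AlgebraicClosure F)).injective
  exact ⟨AlgebraicClosure F, inferInstance, inferInstance, inferInstance,
    (algebraMap F (AlgebraicClosure F)).comp (algebraMap _ F),
    (algebraMap F (AlgebraicClosure F)).injective.comp (IsFractionRing.injective _ F)⟩

theorem mulEval_esymm_field {K : Type*} [Field K] [IsAlgClosed K] [CharZero K] (n : ℕ)
    (s t : Multiset K) : mulEval n s.esymm t.esymm = (mprod s t).esymm n := by
  obtain ⟨s', hs', h⟩ := exists_multiset_esymm n s.esymm
  obtain ⟨t', ht', h'⟩ := exists_multiset_esymm n t.esymm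
  rw [← mulEval_congr h h', mulEval_of_card n s' t' hs' ht']
  refine esymm_eq_of_mpow_eq (N := n) (fun k hk hkn => ?_) n le_rfl
  rw [mpow_mprod, mpow_mprod]
  have key : ∀ u v : Multiset K, (∀ k, 0 < k → k ≤ n → u.esymm k = v.esymm k) →
      mpow k u = mpow k v := fun u v huv => mpow_eq_of_esymm_eq (N := n)
    (fun j hj => by
      rcases Nat.eq_zero_or_pos j with rfl | h0
      · simp
      · exact huv j h0 hj) k hk hkn
  rw [key s' s h, key t' t h']

theorem lamEval_esymm_field {K : Type*} [Field K] [IsAlgClosed K] [CharZero K] (m n : ℕ)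
    (s : Multiset K) : lamEval m n s.esymm = (mwedge n s).esymm m := by
  obtain ⟨s', hs', h⟩ := exists_multiset_esymm (m * n) s.esymm
  rw [← lamEval_congr h, lamEval_of_card m n s' hs']
  refine esymm_eq_of_mpow_eq (N := m) (fun k hk hkm => ?_) m le_rfl
  rw [mpow_mwedge, mpow_mwedge]
  refine esymm_eq_of_mpow_eq (N := n) (fun j hj hjn => ?_) n le_rfl
  rw [mpow_map_pow, mpow_map_pow]
  refine mpow_eq_of_esymm_eq (N := m * n) (fun i hi => ?_) _ (Nat.mul_pos hk hj)
    (Nat.mul_le_mul hkm hjn)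
  rcases Nat.eq_zero_or_pos i with rfl | h0
  · simp
  · exact h i h0 hi

/-- `P_n(e(s); e(t)) = e_n(s t)` for multisets of any size. -/
theorem mulEval_esymm {A : Type*} [CommRing A] (n : ℕ) (s t : Multiset A) :
    mulEval n s.esymm t.esymm = (mprod s t).esymm n := by
  obtain ⟨f, hf⟩ := multiset_eq_map_fin s _ rfl
  obtain ⟨g, hg⟩ := multiset_eq_map_fin t _ rfl
  obtain ⟨K, _, _, _, ψ, hψ⟩ := exists_embedding (Fin s.card ⊕ Fin t.card)
  let φ : MvPolynomial (Fin s.card ⊕ Fin t.card) ℤ →+* A := (aeval (Sum.elim f g)).toRingHom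
  have h1 : (vars (Fin s.card) (τ := Fin s.card ⊕ Fin t.card) Sum.inl).map φ = s := by
    conv_rhs => rw [hf]
    simp only [vars, Multiset.map_map, φ, Function.comp_def]; simp
  have h2 : (vars (Fin t.card) (τ := Fin s.card ⊕ Fin t.card) Sum.inr).map φ = t := by
    conv_rhs => rw [hg]
    simp only [vars, Multiset.map_map, φ, Function.comp_def]; simp
  have h : mulEval n (vars (Fin s.card) (τ := Fin s.card ⊕ Fin t.card) Sum.inl).esymm
      (vars (Fin t.card) Sum.inr).esymm = (mprod (vars (Fin s.card) Sum.inl)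
        (vars (Fin t.card) Sum.inr)).esymm n := by
    apply hψ
    simp only [map_mulEval, map_esymm', map_mprod]
    exact mulEval_esymm_field n _ _
  have h' := congrArg φ h
  simpa only [map_mulEval, map_esymm', map_mprod, h1, h2] using h'

/-- `P_{m,n}(e(s))` is the `m`-th elementary symmetric function of the products of `n` entries
of `s`, for a multiset `s` of any size. -/
theorem lamEval_esymm {A : Type*} [CommRing A] (m n : ℕ) (s : Multiset A) :
    lamEval m n s.esymm = (mwedge n s).esymm m := by
  obtain ⟨f, hf⟩ := multiset_eq_map_fin s _ rfl
  obtain ⟨K, _, _, _, ψ, hψ⟩ := exists_embedding (Fin s.card)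
  let φ : MvPolynomial (Fin s.card) ℤ →+* A := (aeval f).toRingHom
  have h1 : (vars (Fin s.card) id).map φ = s := by
    conv_rhs => rw [hf]
    simp only [vars, Multiset.map_map, φ, Function.comp_def]; simp
  have h : lamEval m n (vars (Fin s.card) id).esymm = (mwedge n (vars (Fin s.card) id)).esymm m := by
    apply hψ
    simp only [map_lamEval, map_esymm', map_mwedge]
    exact lamEval_esymm_field m n _
  have h' := congrArg φ h
  simpa only [map_lamEval, map_esymm', map_mwedge, h1] using h'

end Universal

end SymmPoly

/-- A `λ`-ring structure (called a special `λ`-ring by some authors) on a commutative ring: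
operations `λ^n` such that `λ_t(x) = ∑ λ^n(x) t^n` turns sums into products, and which are
compatible with `1`, products and composition through the universal polynomials `P_n` and
`P_{m,n}`. -/
class LambdaRing (R : Type*) [CommRing R] where
  /-- The operation `λ^n`. -/
  lam : ℕ → R → R
  lam_zero : ∀ x, lam 0 x = 1
  lam_one : ∀ x, lam 1 x = x
  lam_add : ∀ n x y, lam n (x + y) =
    ∑ p ∈ Finset.HasAntidiagonal.antidiagonal n, lam p.1 x * lam p.2 y
  lam_of_one : ∀ n, 2 ≤ n → lam n 1 = 0
  lam_mul : ∀ n x y, lam n (x * y) = SymmPoly.mulEval n (fun i => lam i x) (fun j => lam j y)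
  lam_lam : ∀ m n x, lam m (lam n x) = SymmPoly.lamEval m n (fun i => lam i x)

/-- A homomorphism of `λ`-rings: a ring homomorphism that commutes with all `λ^n`. -/
structure LambdaRingHom (R S : Type*) [CommRing R] [CommRing S] [LambdaRing R] [LambdaRing S]
    extends R →+* S where
  map_lam' : ∀ n x, toFun (LambdaRing.lam n x) = LambdaRing.lam n (toFun x)

/-- The product of `λ`-rings, with componentwise operations. -/
instance Pi.instLambdaRing {ι : Type*} {A : ι → Type*} [∀ i, CommRing (A i)]
    [∀ i, LambdaRing (A i)] : LambdaRing (∀ i, A i) where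
  lam n x i := LambdaRing.lam n (x i)
  lam_zero x := funext fun i => LambdaRing.lam_zero _
  lam_one x := funext fun i => LambdaRing.lam_one _
  lam_add n x y := funext fun i => by simp [LambdaRing.lam_add]
  lam_of_one n hn := funext fun i => LambdaRing.lam_of_one n hn
  lam_mul n x y := funext fun i => by
    have h := SymmPoly.map_mulEval (Pi.evalRingHom A i) n
      (fun k j => LambdaRing.lam k (x j)) (fun k j => LambdaRing.lam k (y j))
    simp only [Pi.evalRingHom_apply] at h
    rw [h]
    exact LambdaRing.lam_mul n (x i) (y i)
  lam_lam m n x := funext fun i => by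
    have h := SymmPoly.map_lamEval (Pi.evalRingHom A i) m n (fun k j => LambdaRing.lam k (x j))
    simp only [Pi.evalRingHom_apply] at h
    rw [h]
    exact LambdaRing.lam_lam m n (x i)

/-- The underlying set `1 + t A[[t]]` of the big Witt ring `W(A)`. -/
@[ext]
structure BigWitt (A : Type*) [CommRing A] where
  /-- The power series. -/
  toSeries : PowerSeries A
  constantCoeff_toSeries : PowerSeries.constantCoeff toSeries = 1

namespace BigWitt

open SymmPoly MvPolynomial

variable {A B : Type*} [CommRing A] [CommRing B]

/-- The coefficient of `t^n`. -/
def coeff (f : BigWitt A) (n : ℕ) : A := PowerSeries.coeff n f.toSeries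

theorem coeff_zero' (f : BigWitt A) : f.coeff 0 = 1 := by
  simpa [coeff] using f.constantCoeff_toSeries

theorem ext_coeff {f g : BigWitt A} (h : ∀ n, f.coeff n = g.coeff n) : f = g :=
  BigWitt.ext (PowerSeries.ext h)

/-- The series `∏ (1 + a t)`, `a` running over `s`. -/
def ofMultiset (s : Multiset A) : BigWitt A :=
  ⟨mser s, by rw [← PowerSeries.coeff_zero_eq_constantCoeff_apply, coeff_mser, esymm_zero']⟩

theorem coeff_ofMultiset (s : Multiset A) (n : ℕ) : (ofMultiset s).coeff n = s.esymm n :=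
  coeff_mser s n

/-- The zero element is the series `1`. -/
instance : Zero (BigWitt A) := ⟨⟨1, by simp⟩⟩

/-- The unit element is the series `1 + t`. -/
instance : One (BigWitt A) := ⟨⟨1 + PowerSeries.X, by simp⟩⟩

/-- Addition is the multiplication of power series. -/
instance : Add (BigWitt A) :=
  ⟨fun f g => ⟨f.toSeries * g.toSeries, by
    simp [f.constantCoeff_toSeries, g.constantCoeff_toSeries]⟩⟩

/-- The negative is the inverse power series. -/
instance : Neg (BigWitt A) := ⟨fun f => ⟨PowerSeries.invOfUnit f.toSeries 1, by simp⟩⟩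

/-- Multiplication is given by the universal polynomials `P_n`, so that
`(1 + a t) * (1 + b t) = 1 + a b t`. -/
instance : Mul (BigWitt A) :=
  ⟨fun f g => ⟨PowerSeries.mk fun n => mulEval n f.coeff g.coeff, by
    rw [← PowerSeries.coeff_zero_eq_constantCoeff_apply, PowerSeries.coeff_mk,
      mulEval_congr (a' := (0 : Multiset A).esymm) (b' := (0 : Multiset A).esymm)
        (fun k _ _ => by omega) (fun k _ _ => by omega), mulEval_esymm, esymm_zero']⟩⟩

/-- The operation `λ^m` on `W(A)`, given by the universal polynomials `P_{k,m}`. -/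
def lam (m : ℕ) (f : BigWitt A) : BigWitt A :=
  ⟨PowerSeries.mk fun k => lamEval k m f.coeff, by
    rw [← PowerSeries.coeff_zero_eq_constantCoeff_apply, PowerSeries.coeff_mk,
      lamEval_congr (a' := (0 : Multiset A).esymm)
        (fun k _ _ => by simp at *; omega), lamEval_esymm, esymm_zero']⟩

theorem coeff_add (f g : BigWitt A) (n : ℕ) : (f + g).coeff n =
    ∑ p ∈ Finset.HasAntidiagonal.antidiagonal n, f.coeff p.1 * g.coeff p.2 :=
  PowerSeries.coeff_mul _ _ _

theorem coeff_mul (f g : BigWitt A) (n : ℕ) : (f * g).coeff n = mulEval n f.coeff g.coeff :=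
  PowerSeries.coeff_mk (R := A) n fun n => mulEval n f.coeff g.coeff

theorem coeff_lam (m : ℕ) (f : BigWitt A) (n : ℕ) : (lam m f).coeff n = lamEval n m f.coeff :=
  PowerSeries.coeff_mk (R := A) n fun n => lamEval n m f.coeff

theorem ofMultiset_add (s t : Multiset A) :
    ofMultiset s + ofMultiset t = ofMultiset (s + t) :=
  BigWitt.ext (mser_add s t).symm

theorem ofMultiset_mul (s t : Multiset A) :
    ofMultiset s * ofMultiset t = ofMultiset (mprod s t) :=
  ext_coeff fun n => by
    rw [coeff_mul, coeff_ofMultiset, ← mulEval_esymm]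
    exact mulEval_congr (fun k _ _ => coeff_ofMultiset s k) (fun k _ _ => coeff_ofMultiset t k)

theorem lam_ofMultiset (m : ℕ) (s : Multiset A) :
    lam m (ofMultiset s) = ofMultiset (mwedge m s) :=
  ext_coeff fun n => by
    rw [coeff_lam, coeff_ofMultiset, ← lamEval_esymm]
    exact lamEval_congr (fun k _ _ => coeff_ofMultiset s k)

theorem ofMultiset_zero : ofMultiset (0 : Multiset A) = 0 :=
  BigWitt.ext (by change mser 0 = 1; simp [mser])

theorem ofMultiset_one : ofMultiset ({1} : Multiset A) = 1 :=
  BigWitt.ext (by simp [ofMultiset, mser]; rfl)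

/-- Functoriality of `W`. -/
def map (φ : A →+* B) (f : BigWitt A) : BigWitt B :=
  ⟨PowerSeries.map φ f.toSeries, by
    rw [← PowerSeries.coeff_zero_eq_constantCoeff_apply, PowerSeries.coeff_map,
      PowerSeries.coeff_zero_eq_constantCoeff_apply, f.constantCoeff_toSeries, map_one]⟩

theorem coeff_map (φ : A →+* B) (f : BigWitt A) (n : ℕ) : (map φ f).coeff n = φ (f.coeff n) :=
  PowerSeries.coeff_map φ n f.toSeries

theorem map_one' (φ : A →+* B) : map φ 1 = 1 := by
  rw [← ofMultiset_one (A := A), ← ofMultiset_one (A := B)]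
  exact ext_coeff fun n => by
    rw [coeff_map, coeff_ofMultiset, coeff_ofMultiset, map_esymm', Multiset.map_singleton, map_one]

theorem map_add' (φ : A →+* B) (f g : BigWitt A) : map φ (f + g) = map φ f + map φ g :=
  ext_coeff fun n => by simp [coeff_map, coeff_add]

theorem map_mul' (φ : A →+* B) (f g : BigWitt A) : map φ (f * g) = map φ f * map φ g :=
  ext_coeff fun n => by simp only [coeff_map, coeff_mul, map_mulEval, funext (coeff_map φ _)]

theorem map_lam' (φ : A →+* B) (m : ℕ) (f : BigWitt A) : map φ (lam m f) = lam m (map φ f) :=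
  ext_coeff fun n => by simp only [coeff_map, coeff_lam, map_lamEval, funext (coeff_map φ _)]

theorem map_injective (φ : A →+* B) (h : Function.Injective φ) :
    Function.Injective (map φ) := fun f g hfg => ext_coeff fun n => h (by
  rw [← coeff_map, ← coeff_map, hfg])

/-- The series `f` and `g` agree up to degree `N`. -/
def Agree (N : ℕ) (f g : BigWitt A) : Prop := ∀ k, k ≤ N → f.coeff k = g.coeff k

theorem Agree.symm {N : ℕ} {f g : BigWitt A} (h : Agree N f g) : Agree N g f :=
  fun k hk => (h k hk).symm

theorem Agree.trans {N : ℕ} {f g h : BigWitt A} (h1 : Agree N f g) (h2 : Agree N g h) :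
    Agree N f h := fun k hk => (h1 k hk).trans (h2 k hk)

theorem Agree.mono {M N : ℕ} {f g : BigWitt A} (h : Agree N f g) (hM : M ≤ N) : Agree M f g :=
  fun k hk => h k (hk.trans hM)

theorem Agree.add {N : ℕ} {f g f' g' : BigWitt A} (h : Agree N f f') (h' : Agree N g g') :
    Agree N (f + g) (f' + g') := fun k hk => by
  rw [coeff_add, coeff_add]
  refine Finset.sum_congr rfl fun p hp => ?_
  rw [Finset.HasAntidiagonal.mem_antidiagonal] at hp
  rw [h _ (by omega), h' _ (by omega)]

theorem Agree.mul {N : ℕ} {f g f' g' : BigWitt A} (h : Agree N f f') (h' : Agree N g g') :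
    Agree N (f * g) (f' * g') := fun k hk => by
  rw [coeff_mul, coeff_mul]
  exact mulEval_congr (fun j _ hj => h j (hj.trans hk)) (fun j _ hj => h' j (hj.trans hk))

theorem Agree.lam {N m : ℕ} {f f' : BigWitt A} (h : Agree (N * m) f f') :
    Agree N (lam m f) (lam m f') := fun k hk => by
  rw [coeff_lam, coeff_lam]
  exact lamEval_congr (fun j _ hj => h j (hj.trans (Nat.mul_le_mul_right m hk)))

theorem eq_of_agree {f g : BigWitt A} (h : ∀ N, Agree N f g) : f = g :=
  ext_coeff fun n => h n n le_rfl

theorem exists_agree {K : Type*} [Field K] [IsAlgClosed K] (N : ℕ) (f : BigWitt K) :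
    ∃ s : Multiset K, Agree N f (ofMultiset s) := by
  obtain ⟨s, _, h⟩ := exists_multiset_esymm N f.coeff
  refine ⟨s, fun k hk => ?_⟩
  rw [coeff_ofMultiset]
  rcases Nat.eq_zero_or_pos k with rfl | h0
  · rw [coeff_zero', esymm_zero']
  · exact (h k h0 hk).symm

/-- Elements of `W(A)` lift to `W` of a polynomial ring over `ℤ`. -/
theorem exists_lift (f g h : BigWitt A) : ∃ (φ : MvPolynomial (Fin 3 × ℕ) ℤ →+* A)
    (F G H : BigWitt (MvPolynomial (Fin 3 × ℕ) ℤ)), map φ F = f ∧ map φ G = g ∧ map φ H = h := by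
  let φ : MvPolynomial (Fin 3 × ℕ) ℤ →+* A :=
    (aeval fun p : Fin 3 × ℕ => (![f, g, h] p.1).coeff p.2).toRingHom
  let F : Fin 3 → BigWitt (MvPolynomial (Fin 3 × ℕ) ℤ) := fun i =>
    ⟨PowerSeries.mk fun n => if n = 0 then 1 else X (i, n), by
      rw [← PowerSeries.coeff_zero_eq_constantCoeff_apply, PowerSeries.coeff_mk, if_pos rfl]⟩
  have hF : ∀ i, map φ (F i) = ![f, g, h] i := fun i => ext_coeff fun n => by
    rw [coeff_map]
    by_cases hn : n = 0
    · subst hn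
      rw [coeff_zero', coeff_zero', map_one]
    · simp [coeff, F, hn, φ]
  exact ⟨φ, F 0, F 1, F 2, hF 0, hF 1, hF 2⟩

theorem mul_comm_field {K : Type*} [Field K] [IsAlgClosed K] (f g : BigWitt K) :
    f * g = g * f := eq_of_agree fun N => by
  obtain ⟨s, hs⟩ := exists_agree N f
  obtain ⟨t, ht⟩ := exists_agree N g
  refine (hs.mul ht).trans (Agree.trans ?_ (ht.mul hs).symm)
  rw [ofMultiset_mul, ofMultiset_mul, mprod_comm]
  exact fun _ _ => rfl

theorem mul_assoc_field {K : Type*} [Field K] [IsAlgClosed K] (f g h : BigWitt K) :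
    f * g * h = f * (g * h) := eq_of_agree fun N => by
  obtain ⟨s, hs⟩ := exists_agree N f
  obtain ⟨t, ht⟩ := exists_agree N g
  obtain ⟨u, hu⟩ := exists_agree N h
  refine ((hs.mul ht).mul hu).trans (Agree.trans ?_ (hs.mul (ht.mul hu)).symm)
  simp only [ofMultiset_mul, mprod_assoc]
  exact fun _ _ => rfl

theorem mul_add_field {K : Type*} [Field K] [IsAlgClosed K] (f g h : BigWitt K) :
    f * (g + h) = f * g + f * h := eq_of_agree fun N => by
  obtain ⟨s, hs⟩ := exists_agree N f
  obtain ⟨t, ht⟩ := exists_agree N g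
  obtain ⟨u, hu⟩ := exists_agree N h
  refine (hs.mul (ht.add hu)).trans (Agree.trans ?_ ((hs.mul ht).add (hs.mul hu)).symm)
  simp only [ofMultiset_mul, ofMultiset_add, mprod_add]
  exact fun _ _ => rfl

theorem one_mul_field {K : Type*} [Field K] [IsAlgClosed K] (f : BigWitt K) :
    1 * f = f := eq_of_agree fun N => by
  obtain ⟨s, hs⟩ := exists_agree N f
  have h1 : Agree N (1 : BigWitt K) (ofMultiset {1}) := by
    rw [ofMultiset_one]; exact fun _ _ => rfl
  refine (h1.mul hs).trans (Agree.trans ?_ hs.symm)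
  rw [ofMultiset_mul, one_mprod]
  exact fun _ _ => rfl

protected theorem mul_comm' (f g : BigWitt A) : f * g = g * f := by
  obtain ⟨φ, F, G, H, rfl, rfl, -⟩ := exists_lift f g 0
  obtain ⟨K, _, _, _, ψ, hψ⟩ := exists_embedding (Fin 3 × ℕ)
  rw [← map_mul', ← map_mul']
  congr 1
  apply map_injective ψ hψ
  simp only [map_mul', mul_comm_field]

protected theorem mul_assoc' (f g h : BigWitt A) : f * g * h = f * (g * h) := by
  obtain ⟨φ, F, G, H, rfl, rfl, rfl⟩ := exists_lift f g h
  obtain ⟨K, _, _, _, ψ, hψ⟩ := exists_embedding (Fin 3 × ℕ)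
  simp only [← map_mul']
  congr 1
  apply map_injective ψ hψ
  simp only [map_mul', mul_assoc_field]

protected theorem mul_add' (f g h : BigWitt A) : f * (g + h) = f * g + f * h := by
  obtain ⟨φ, F, G, H, rfl, rfl, rfl⟩ := exists_lift f g h
  obtain ⟨K, _, _, _, ψ, hψ⟩ := exists_embedding (Fin 3 × ℕ)
  simp only [← map_mul', ← map_add']
  congr 1
  apply map_injective ψ hψ
  simp only [map_mul', map_add', mul_add_field]

protected theorem one_mul' (f : BigWitt A) : 1 * f = f := by
  obtain ⟨φ, F, G, H, rfl, -, -⟩ := exists_lift f 0 0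
  obtain ⟨K, _, _, _, ψ, hψ⟩ := exists_embedding (Fin 3 × ℕ)
  rw [← map_one' φ, ← map_mul']
  congr 1
  apply map_injective ψ hψ
  simp only [map_mul', map_one', one_mul_field]

instance : AddCommGroup (BigWitt A) where
  add_assoc f g h := BigWitt.ext (mul_assoc f.toSeries g.toSeries h.toSeries)
  zero_add f := BigWitt.ext (one_mul f.toSeries)
  add_zero f := BigWitt.ext (mul_one f.toSeries)
  add_comm f g := BigWitt.ext (mul_comm f.toSeries g.toSeries)
  neg_add_cancel f := BigWitt.ext (by
    change PowerSeries.invOfUnit f.toSeries 1 * f.toSeries = 1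
    rw [mul_comm]
    exact PowerSeries.mul_invOfUnit _ _ (by simp [f.constantCoeff_toSeries]))
  nsmul := nsmulRec
  zsmul := zsmulRec

protected theorem mul_zero' (f : BigWitt A) : f * 0 = 0 := by
  have h := BigWitt.mul_add' f 0 0
  rw [add_zero] at h
  exact left_eq_add.mp h

/-- The big Witt ring `W(A)`. -/
instance : CommRing (BigWitt A) where
  mul_assoc := BigWitt.mul_assoc'
  mul_comm := BigWitt.mul_comm'
  one_mul := BigWitt.one_mul'
  mul_one f := by rw [BigWitt.mul_comm', BigWitt.one_mul']
  left_distrib := BigWitt.mul_add'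
  right_distrib f g h := by
    rw [BigWitt.mul_comm', BigWitt.mul_add', BigWitt.mul_comm' h f, BigWitt.mul_comm' h g]
  zero_mul f := by rw [BigWitt.mul_comm', BigWitt.mul_zero']
  mul_zero := BigWitt.mul_zero'
  neg_add_cancel := neg_add_cancel
  zsmul := zsmulRec

/-- `W(φ)` as a ring homomorphism. -/
def mapHom (φ : A →+* B) : BigWitt A →+* BigWitt B where
  toFun := map φ
  map_one' := map_one' φ
  map_mul' := map_mul' φ
  map_zero' := by
    have h := map_add' φ 0 0
    rw [add_zero] at h
    exact left_eq_add.mp h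
  map_add' := map_add' φ

theorem mapHom_apply (φ : A →+* B) (f : BigWitt A) : mapHom φ f = map φ f := rfl

theorem sum_teich (s : Multiset A) :
    (s.map fun a => ofMultiset {a}).sum = ofMultiset s := by
  induction s using Multiset.induction_on with
  | empty => rw [ofMultiset_zero]; rfl
  | cons a s ih =>
    rw [Multiset.map_cons, Multiset.sum_cons, ih, ofMultiset_add, Multiset.singleton_add]

theorem prod_teich (s : Multiset A) :
    (s.map fun a => ofMultiset {a}).prod = ofMultiset {s.prod} := by
  induction s using Multiset.induction_on with
  | empty => simp [ofMultiset_one]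
  | cons a s ih =>
    rw [Multiset.map_cons, Multiset.prod_cons, ih, ofMultiset_mul, Multiset.prod_cons]
    simp [mprod]

theorem esymm_teich (n : ℕ) (s : Multiset A) :
    (s.map fun a => ofMultiset {a}).esymm n = lam n (ofMultiset s) := by
  rw [lam_ofMultiset, ← sum_teich, esymm_eq_sum_mwedge]
  congr 1
  simp only [mwedge, Multiset.powersetCard_map, Multiset.map_map, Function.comp_def, prod_teich]

theorem mprod_teich (s t : Multiset A) :
    mprod (s.map fun a => ofMultiset {a}) (t.map fun a => ofMultiset {a}) =
      (mprod s t).map fun a => ofMultiset {a} := by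
  have h : ∀ a b : A, ofMultiset {a} * ofMultiset {b} = ofMultiset {a * b} := fun a b => by
    rw [ofMultiset_mul]; simp [mprod]
  simp only [mprod, Multiset.bind_map, Multiset.map_bind, Multiset.map_map, Function.comp_def, h]

theorem mwedge_teich (n : ℕ) (s : Multiset A) :
    mwedge n (s.map fun a => ofMultiset {a}) = (mwedge n s).map fun a => ofMultiset {a} := by
  simp only [mwedge, Multiset.powersetCard_map, Multiset.map_map, Function.comp_def, prod_teich]

theorem agree_sum {ι : Type*} (S : Finset ι) {N : ℕ} {F G : ι → BigWitt A}
    (h : ∀ i ∈ S, Agree N (F i) (G i)) : Agree N (∑ i ∈ S, F i) (∑ i ∈ S, G i) := by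
  classical
  induction S using Finset.induction_on with
  | empty => exact fun _ _ => rfl
  | insert a S ha ih =>
    rw [Finset.sum_insert ha, Finset.sum_insert ha]
    exact (h a (Finset.mem_insert_self a S)).add
      (ih fun i hi => h i (Finset.mem_insert_of_mem hi))

theorem agree_aeval {σ : Type*} {N : ℕ} {F G : σ → BigWitt A} (h : ∀ i, Agree N (F i) (G i))
    (P : MvPolynomial σ ℤ) : Agree N (aeval F P) (aeval G P) := by
  induction P using MvPolynomial.induction_on with
  | C a => rw [aeval_C, aeval_C]; exact fun _ _ => rfl
  | add p q hp hq => simpa only [map_add] using hp.add hq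
  | mul_X p i hp => simpa only [map_mul, aeval_X] using hp.mul (h i)

theorem agree_mulEval {N n : ℕ} {F G F' G' : ℕ → BigWitt A} (h : ∀ i, i ≤ n → Agree N (F i) (F' i))
    (h' : ∀ i, i ≤ n → Agree N (G i) (G' i)) : Agree N (mulEval n F G) (mulEval n F' G') :=
  agree_aeval (fun i => by
    rcases i with i | i
    · exact h _ (by omega)
    · exact h' _ (by omega)) _

theorem agree_lamEval {N m n : ℕ} {F F' : ℕ → BigWitt A}
    (h : ∀ i, i ≤ m * n → Agree N (F i) (F' i)) : Agree N (lamEval m n F) (lamEval m n F') :=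
  agree_aeval (fun i => h _ (by omega)) _

theorem lam_zero' (f : BigWitt A) : lam 0 f = 1 := by
  rw [← ofMultiset_one]
  refine ext_coeff fun n => ?_
  rw [coeff_lam, coeff_ofMultiset, lamEval_congr (a' := (0 : Multiset A).esymm)
        (fun k _ _ => by simp at *; omega), lamEval_esymm]
  simp [mwedge]

theorem lam_of_one' (n : ℕ) (hn : 2 ≤ n) : lam n (1 : BigWitt A) = 0 := by
  rw [← ofMultiset_one, lam_ofMultiset, mwedge, Multiset.powersetCard_eq_empty, ← ofMultiset_zero]
  · rfl
  · rw [Multiset.card_singleton]; exact hn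

theorem lam_one_field {K : Type*} [Field K] [IsAlgClosed K] (f : BigWitt K) : lam 1 f = f :=
  eq_of_agree fun N => by
    obtain ⟨s, hs⟩ := exists_agree N f
    refine Agree.trans (Agree.lam (hs.mono (by omega))) (Agree.trans ?_ hs.symm)
    rw [lam_ofMultiset]
    have : mwedge 1 s = s := by simp [mwedge, Multiset.powersetCard_one]
    rw [this]
    exact fun _ _ => rfl

theorem lam_add_field {K : Type*} [Field K] [IsAlgClosed K] (n : ℕ) (f g : BigWitt K) :
    lam n (f + g) = ∑ p ∈ Finset.HasAntidiagonal.antidiagonal n, lam p.1 f * lam p.2 g :=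
  eq_of_agree fun N => by
    obtain ⟨s, hs⟩ := exists_agree (N * n) f
    obtain ⟨t, ht⟩ := exists_agree (N * n) g
    refine Agree.trans (Agree.lam (hs.add ht)) (Agree.trans ?_ (agree_sum _ fun p hp =>
      (Agree.lam (hs.mono ?_)).mul (Agree.lam (ht.mono ?_))).symm)
    · simp only [ofMultiset_add, ← esymm_teich, Multiset.map_add, SymmPoly.esymm_add]
      exact fun _ _ => rfl
    all_goals
      rw [Finset.HasAntidiagonal.mem_antidiagonal] at hp
      exact Nat.mul_le_mul_left N (by omega)

theorem lam_mul_field {K : Type*} [Field K] [IsAlgClosed K] (n : ℕ) (f g : BigWitt K) :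
    lam n (f * g) = mulEval n (fun i => lam i f) (fun j => lam j g) :=
  eq_of_agree fun N => by
    obtain ⟨s, hs⟩ := exists_agree (N * n) f
    obtain ⟨t, ht⟩ := exists_agree (N * n) g
    refine Agree.trans (Agree.lam (hs.mul ht)) (Agree.trans ?_ (agree_mulEval
      (fun i hi => Agree.lam (hs.mono (Nat.mul_le_mul_left N hi)))
      (fun i hi => Agree.lam (ht.mono (Nat.mul_le_mul_left N hi)))).symm)
    simp only [ofMultiset_mul, ← esymm_teich, ← mprod_teich, ← mulEval_esymm]
    exact fun _ _ => rfl

theorem lam_lam_field {K : Type*} [Field K] [IsAlgClosed K] (m n : ℕ) (f : BigWitt K) :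
    lam m (lam n f) = lamEval m n (fun i => lam i f) :=
  eq_of_agree fun N => by
    obtain ⟨s, hs⟩ := exists_agree (N * (m * n)) f
    refine Agree.trans (Agree.lam (Agree.lam (hs.mono (mul_assoc N m n).le)))
      (Agree.trans ?_ (agree_lamEval
      (fun i hi => Agree.lam (hs.mono (Nat.mul_le_mul_left N hi)))).symm)
    rw [lam_ofMultiset]
    simp only [← esymm_teich, ← mwedge_teich, ← lamEval_esymm]
    exact fun _ _ => rfl

/-- The `λ`-ring structure of `W(A)`. -/
instance : LambdaRing (BigWitt A) where
  lam := lam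
  lam_zero := lam_zero'
  lam_of_one := lam_of_one'
  lam_one f := by
    obtain ⟨φ, F, G, H, rfl, -, -⟩ := exists_lift f 0 0
    obtain ⟨K, _, _, _, ψ, hψ⟩ := exists_embedding (Fin 3 × ℕ)
    rw [← map_lam']
    congr 1
    apply map_injective ψ hψ
    rw [map_lam', lam_one_field]
  lam_add n f g := by
    obtain ⟨φ, F, G, H, rfl, rfl, -⟩ := exists_lift f g 0
    obtain ⟨K, _, _, _, ψ, hψ⟩ := exists_embedding (Fin 3 × ℕ)
    have key : lam n (F + G) =
        ∑ p ∈ Finset.HasAntidiagonal.antidiagonal n, lam p.1 F * lam p.2 G := by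
      apply map_injective ψ hψ
      rw [map_lam', map_add', lam_add_field, ← mapHom_apply ψ (∑ _ ∈ _, _), map_sum]
      simp only [mapHom_apply, map_mul', map_lam']
    have h := congrArg (mapHom φ) key
    rw [map_sum] at h
    simpa only [mapHom_apply, map_mul', map_lam', map_add'] using h
  lam_mul n f g := by
    obtain ⟨φ, F, G, H, rfl, rfl, -⟩ := exists_lift f g 0
    obtain ⟨K, _, _, _, ψ, hψ⟩ := exists_embedding (Fin 3 × ℕ)
    have key : lam n (F * G) = mulEval n (fun i => lam i F) (fun j => lam j G) := by
      apply map_injective ψ hψ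
      rw [map_lam', map_mul', lam_mul_field, ← mapHom_apply ψ (mulEval _ _ _), map_mulEval]
      simp only [mapHom_apply, map_lam']
    have h := congrArg (mapHom φ) key
    rw [map_mulEval] at h
    simpa only [mapHom_apply, map_mul', map_lam'] using h
  lam_lam m n f := by
    obtain ⟨φ, F, G, H, rfl, -, -⟩ := exists_lift f 0 0
    obtain ⟨K, _, _, _, ψ, hψ⟩ := exists_embedding (Fin 3 × ℕ)
    have key : lam m (lam n F) = lamEval m n (fun i => lam i F) := by
      apply map_injective ψ hψ
      rw [map_lam', map_lam', lam_lam_field, ← mapHom_apply ψ (lamEval _ _ _), map_lamEval]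
      simp only [mapHom_apply, map_lam']
    have h := congrArg (mapHom φ) key
    rw [map_lamEval] at h
    simpa only [mapHom_apply, map_lam'] using h

end BigWitt

section SchurFinite

variable {R : Type*} [CommRing R] [LambdaRing R]

/-- `x` is a line element: `λ^n(x) = 0` for all `n > 1`. -/
def IsLineElement (x : R) : Prop := ∀ n, 1 < n → LambdaRing.lam n x = 0

/-- The value `s_π(x)` of the Schur polynomial of the partition `π`, given by the Jacobi–Trudi
determinant `det (e_{π'_i + j - i})` evaluated at `e_k = λ^k(x)`, where `π'` is the conjugate
partition (the column lengths of `π`) and `e_k = 0` for `k < 0`. -/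
def schurValue (π : YoungDiagram) (x : R) : R :=
  Matrix.det (Matrix.of fun i j : Fin (π.rowLen 0) =>
    if (i : ℕ) ≤ π.colLen i + j then LambdaRing.lam (π.colLen i + j - i) x else 0)

/-- `x` is Schur-finite: there is a partition `κ` such that `s_π(x) = 0` for every partition `π`
containing `κ`. -/
def IsSchurFinite (x : R) : Prop :=
  ∃ κ : YoungDiagram, ∀ π : YoungDiagram, κ ≤ π → schurValue π x = 0

end SchurFinite

end

open SymmPoly

/-! ### Vanishing Hankel minors and linear recurrences. -/

section Recurrence

/-! A ring homomorphism `g` from `R` to a commutative ring `A` induces a homomorphism of λ-rings `R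
→ W(A)`, sending `x` to the series with coefficients `g(λ^n(x))`: the λ-ring axioms of `R` and the
operations of `W(A)` use the same universal polynomials. For each prime `p`, take `A` to be an
algebraic closure of the residue field at `p`. The coefficient of `t` recovers `g(x)`, so an element
killed at every prime is nilpotent, hence zero in a reduced ring.

Schur-finiteness makes these series rational. If `κ` is the given partition and `c` its number of
cells, every partition with exactly `c` columns, all of length at least `c`, contains `κ`. The
corresponding Jacobi–Trudi determinants are the `c × c` minors of the Hankel matrix `(λ^{k+j}(x))`
on `c` successive columns and rows `k ≥ c` (`IsSchurFinite.exists_det_eq_zero`). Over a field, their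
vanishing gives a linear recurrence on the coefficients (`exists_recurrence_of_det_eq_zero`), so the
series is a quotient of polynomials with constant term 1 (`BigWitt.exists_add_eq_of_recurrence`).
Over an algebraically closed field these factor into terms `1 + at`, which are line elements of the
Witt ring, and division of series is subtraction there.

The degree bounds `2c` and `c` depend only on `x`, not on the prime
(`IsSchurFinite.exists_lambdaSeries_eq`), so the local factors assemble into finitely many line
elements of the product. -/

theorem exists_recurrence_of_det_eq_zero {K : Type*} [Field K] (a : ℕ → K) (c k₀ : ℕ)
    (h : ∀ g : Fin c → ℕ, StrictAnti g → (∀ i, k₀ ≤ g i) →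
      Matrix.det (Matrix.of fun i j : Fin c => a (g i + j)) = 0) :
    ∃ v : Fin c → K, v ≠ 0 ∧ ∀ k, k₀ ≤ k → ∑ j, v j * a (k + j) = 0 := by
  let w : {k : ℕ // k₀ ≤ k} → Fin c → K := fun k j => a (k + j)
  -- If the Hankel rows spanned `K^c`, some `c` of them would form a basis, giving a nonzero minor.
  have hspan : Submodule.span K (Set.range w) < ⊤ := by
    rw [lt_top_iff_ne_top]
    intro htop
    obtain ⟨κ, b, hb, hspan, hli⟩ := exists_linearIndependent' K w
    have : Fintype κ := @Fintype.ofFinite _ hli.finite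
    have hcard : Fintype.card κ = c := by
      have h1 := finrank_span_eq_card hli
      rw [hspan, htop, finrank_top, Module.finrank_fin_fun] at h1
      exact h1.symm
    let S : Finset {k : ℕ // k₀ ≤ k} := Finset.univ.map ⟨b, hb⟩
    have hS : S.card = c := by rw [Finset.card_map, Finset.card_univ, hcard]
    let e := S.orderIsoOfFin hS
    have hmem : ∀ i, ∃ x, b x = (e i : {k : ℕ // k₀ ≤ k}) := fun i => by
      obtain ⟨x, -, hx⟩ := Finset.mem_map.mp (e i).2
      exact ⟨x, hx⟩
    choose q hq using hmem
    have hqinj : Function.Injective q := fun i j hij => e.injective (Subtype.ext (by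
      rw [← hq, ← hq, hij]))
    -- `e` lists the chosen row indices increasingly; reversing it gives the decreasing order that
    -- `h` expects.
    have hdet := h (fun i => ((e (Fin.rev i)).1 : ℕ))
      (fun i j hij => (e.strictMono (Fin.rev_lt_rev.mpr hij))) (fun i => (e (Fin.rev i)).1.2)
    have hli' : LinearIndependent K (fun i => (w ∘ b) (q (Fin.rev i))) :=
      hli.comp _ (hqinj.comp Fin.rev_injective)
    have hrow : (Matrix.of fun i j : Fin c => a (((e (Fin.rev i)).1 : ℕ) + j)).row =
        fun i => (w ∘ b) (q (Fin.rev i)) := by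
      funext i j
      simp [w, hq, Matrix.row]
    rw [← hrow, Matrix.linearIndependent_rows_iff_isUnit, Matrix.isUnit_iff_isUnit_det, hdet] at hli'
    exact not_isUnit_zero hli'
  obtain ⟨f, hf, hle⟩ := Submodule.exists_le_ker_of_lt_top _ hspan
  -- A nonzero functional vanishing on all rows is the recurrence; its values on the standard basis
  -- are the coefficients.
  refine ⟨fun j => f (Pi.single j 1), fun h0 => hf ?_, fun k hk => ?_⟩
  · refine LinearMap.pi_ext' fun j => LinearMap.ext_ring ?_
    simpa using congrFun h0 j
  · have h1 : f (w ⟨k, hk⟩) = 0 := hle (Submodule.subset_span ⟨_, rfl⟩)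
    rw [LinearMap.pi_apply_eq_sum_univ f] at h1
    simp only [w, smul_eq_mul] at h1
    rw [← h1]
    exact Finset.sum_congr rfl fun j _ => by
      rw [mul_comm]
      refine congrArg (_ * f ·) (funext fun i => ?_)
      simp [Pi.single_apply, eq_comm]

end Recurrence

/-! ### Young diagrams with prescribed columns. -/

namespace YoungDiagram

/-- The Young diagram with `c` columns of lengths `μ 0 ≥ μ 1 ≥ ⋯`. -/
def ofColumns (c : ℕ) (μ : ℕ → ℕ) (hμ : ∀ i j, i ≤ j → j < c → μ j ≤ μ i) : YoungDiagram where
  cells := (Finset.range (μ 0) ×ˢ Finset.range c).filter fun p => p.1 < μ p.2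
  isLowerSet := by
    rintro ⟨i, j⟩ ⟨i', j'⟩ hle hmem
    obtain ⟨h1, h2⟩ := Prod.mk_le_mk.mp hle
    simp only [Finset.coe_filter, Finset.mem_product, Finset.mem_range, Set.mem_ofPred_eq] at hmem ⊢
    have := hμ j' j h2 hmem.1.2
    omega

theorem mem_ofColumns {c : ℕ} {μ : ℕ → ℕ} {hμ : ∀ i j, i ≤ j → j < c → μ j ≤ μ i} {i j : ℕ} :
    (i, j) ∈ ofColumns c μ hμ ↔ j < c ∧ i < μ j := by
  rw [← mem_cells]
  simp only [ofColumns, Finset.mem_filter, Finset.mem_product, Finset.mem_range]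
  constructor
  · omega
  · intro h
    have := hμ 0 j (Nat.zero_le _) h.1
    omega

theorem colLen_ofColumns {c : ℕ} {μ : ℕ → ℕ} {hμ : ∀ i j, i ≤ j → j < c → μ j ≤ μ i} {j : ℕ}
    (hj : j < c) : (ofColumns c μ hμ).colLen j = μ j :=
  eq_of_forall_lt_iff fun i => by rw [← mem_iff_lt_colLen, mem_ofColumns]; simp [hj]

/-- Positive columns are needed because an empty one would shorten the first row, whose length is
the size of the Jacobi–Trudi matrix. -/
theorem rowLen_zero_ofColumns {c : ℕ} {μ : ℕ → ℕ} {hμ : ∀ i j, i ≤ j → j < c → μ j ≤ μ i}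
    (hpos : ∀ j, j < c → 0 < μ j) : (ofColumns c μ hμ).rowLen 0 = c :=
  eq_of_forall_lt_iff fun j => by
    rw [← mem_iff_lt_rowLen, mem_ofColumns]
    exact ⟨fun h => h.1, fun h => ⟨h, hpos j h⟩⟩

/-- Together with `snd_lt_card`, this crude bound places `κ` inside a square of side `κ.card`. -/
theorem fst_lt_card {κ : YoungDiagram} {i j : ℕ} (h : (i, j) ∈ κ) : i < κ.card := by
  have h1 : i < κ.colLen j := mem_iff_lt_colLen.mp h
  rw [colLen_eq_card] at h1
  exact h1.trans_le (Finset.card_le_card (Finset.filter_subset _ _))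

theorem snd_lt_card {κ : YoungDiagram} {i j : ℕ} (h : (i, j) ∈ κ) : j < κ.card := by
  have h1 : j < κ.rowLen i := mem_iff_lt_rowLen.mp h
  rw [rowLen_eq_card] at h1
  exact h1.trans_le (Finset.card_le_card (Finset.filter_subset _ _))

end YoungDiagram

/-! ### Jacobi–Trudi determinants as Hankel minors. -/

section SchurFinite

variable {R : Type*} [CommRing R] [LambdaRing R]

theorem schurValue_eq_det {c : ℕ} {π : YoungDiagram} (hc : π.rowLen 0 = c) (x : R) :
    schurValue π x = Matrix.det (Matrix.of fun i j : Fin c =>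
      if (i : ℕ) ≤ π.colLen i + j then LambdaRing.lam (π.colLen i + j - i) x else 0) := by
  subst hc
  rfl

/-- If `x` is Schur-finite, then all minors of size `c` of the Hankel matrix `(λ^{i+j}(x))`
formed by `c` successive columns and by rows of index at least `c` vanish. -/
theorem IsSchurFinite.exists_det_eq_zero {x : R} (hx : IsSchurFinite x) :
    ∃ c : ℕ, ∀ g : Fin c → ℕ, StrictAnti g → (∀ i, c ≤ g i) →
      Matrix.det (Matrix.of fun i j : Fin c => LambdaRing.lam (g i + j) x) = 0 := by
  obtain ⟨κ, hκ⟩ := hx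
  refine ⟨κ.card, fun g hg hge => ?_⟩
  -- The shift by `i` cancels the `- i` in the Jacobi–Trudi entry, leaving index `g i + j`. The
  -- value beyond the last column plays no role.
  let μ : ℕ → ℕ := fun i => if h : i < κ.card then g ⟨i, h⟩ + i else 0
  have hμge : ∀ i, i < κ.card → κ.card ≤ μ i := fun i hi => by
    simp only [μ, dif_pos hi]
    have := hge ⟨i, hi⟩
    omega
  -- A strictly decreasing `g` loses at least 1 at each step, so `g i + i` is weakly decreasing.
  have hstep : ∀ d i (h : i + d < κ.card), g ⟨i + d, h⟩ + d ≤ g ⟨i, by omega⟩ := by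
    intro d
    induction d with
    | zero => intro i h; simp
    | succ d ih =>
      intro i h
      have h1 := ih i (by omega)
      have h2 : g ⟨i + (d + 1), h⟩ < g ⟨i + d, by omega⟩ := hg (by simp [Fin.lt_def])
      omega
  have hμ : ∀ i j, i ≤ j → j < κ.card → μ j ≤ μ i := fun i j hij hj => by
    obtain ⟨d, rfl⟩ := Nat.exists_eq_add_of_le hij
    have := hstep d i hj
    simp only [μ, dif_pos hj, dif_pos (show i < κ.card by omega)]
    omega
  -- The new diagram contains the full square of side `κ.card`, hence `κ`.
  have hle : κ ≤ YoungDiagram.ofColumns κ.card μ hμ := by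
    rintro ⟨i, j⟩ hij
    have hj := YoungDiagram.snd_lt_card hij
    exact YoungDiagram.mem_ofColumns.mpr
      ⟨hj, (YoungDiagram.fst_lt_card hij).trans_le (hμge j hj)⟩
  have h := hκ _ hle
  rw [schurValue_eq_det (YoungDiagram.rowLen_zero_ofColumns fun j hj =>
    (Nat.zero_lt_of_lt hj).trans_le (hμge j hj))] at h
  rw [← h]
  congr 2
  funext i j
  rw [YoungDiagram.colLen_ofColumns i.2]
  simp only [μ, dif_pos i.2]
  -- No entry has negative index, since column `i` has length `g i + i ≥ i`.
  rw [if_pos (by omega)]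
  congr 1
  simp only [Fin.eta]
  omega

end SchurFinite

/-! ### Splitting and rationality in the Witt ring of a field. -/

namespace BigWitt

theorem coeff_one {A : Type*} [CommRing A] (n : ℕ) :
    (1 : BigWitt A).coeff n = ({1} : Multiset A).esymm n := by
  rw [← ofMultiset_one, coeff_ofMultiset]

/-- A Witt vector of finite degree over an algebraically closed field splits. -/
theorem exists_ofMultiset_eq {K : Type*} [Field K] [IsAlgClosed K] (N : ℕ) (f : BigWitt K)
    (hf : ∀ k, N < k → f.coeff k = 0) : ∃ s : Multiset K, s.card = N ∧ ofMultiset s = f := by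
  -- The multiset may contain zeros, contributing trivial factors; this keeps its size exactly `N`
  -- even when the degree of `f` is smaller.
  obtain ⟨s, hs, h⟩ := exists_multiset_esymm N f.coeff
  refine ⟨s, hs, ext_coeff fun k => ?_⟩
  rw [coeff_ofMultiset]
  rcases Nat.eq_zero_or_pos k with rfl | h0
  · rw [coeff_zero', esymm_zero']
  · rcases le_or_gt k N with hk | hk
    · exact h k h0 hk
    · rw [hf k hk, esymm_eq_zero s k (hs ▸ hk)]

theorem exists_ofMultiset_eq_sum {A : Type*} [CommRing A] {N : ℕ} (s : Multiset A)
    (hs : s.card = N) : ∃ α : Fin N → A, ofMultiset s = ∑ i, ofMultiset {α i} := by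
  obtain ⟨α, hα⟩ := multiset_eq_map_fin s N hs
  refine ⟨α, ?_⟩
  rw [← sum_teich, hα, Multiset.map_map]
  rfl

/-- The operation `λ^n` runs over products of `n` entries at distinct positions, and a singleton
offers none for `n > 1`. -/
theorem isLineElement_ofMultiset_singleton {A : Type*} [CommRing A] (a : A) :
    IsLineElement (ofMultiset {a}) := fun n hn => by
  change lam n (ofMultiset {a}) = 0
  rw [lam_ofMultiset, mwedge, Multiset.powersetCard_eq_empty n (by simpa using hn),
    ← ofMultiset_zero]
  rfl

/-- A Witt vector whose coefficients satisfy a linear recurrence is a difference of two Witt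
vectors of bounded degree. -/
theorem exists_add_eq_of_recurrence {K : Type*} [Field K] (f : BigWitt K) {c k₀ : ℕ}
    {v : Fin c → K} (hv : v ≠ 0) (h : ∀ k, k₀ ≤ k → ∑ j, v j * f.coeff (k + j) = 0) :
    ∃ Q : BigWitt K, (∀ k, c < k → Q.coeff k = 0) ∧ ∀ k, k₀ + c < k → (f + Q).coeff k = 0 := by
  obtain ⟨j₀, hj₀⟩ := Function.ne_iff.mp hv
  let u : ℕ → K := fun j => if h : j < c then v ⟨j, h⟩ else 0
  have hu : ∀ k, k₀ ≤ k → ∑ j ∈ Finset.range c, u j * f.coeff (k + j) = 0 := fun k hk => by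
    rw [Finset.sum_range, ← h k hk]
    exact Finset.sum_congr rfl fun j _ => by simp [u]
  -- The last entries of `v` may vanish, so the order of the recurrence is its largest nonzero index
  -- `d`.
  have hex : ∃ d, d < c ∧ u d ≠ 0 ∧ ∀ j, d < j → u j = 0 := by
    classical
    let T := (Finset.range c).filter fun j => u j ≠ 0
    have hT : T.Nonempty := ⟨j₀, by simpa [T, u] using hj₀⟩
    have hd := T.max'_mem hT
    simp only [T, Finset.mem_filter, Finset.mem_range] at hd
    refine ⟨T.max' hT, hd.1, hd.2, fun j hj => ?_⟩
    by_contra hne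
    have hjc : j < c := by
      by_contra hjc
      exact hne (dif_neg hjc)
    exact absurd (T.le_max' j (by simp [T, hne, hjc])) (not_le.mpr hj)
  obtain ⟨d, hdc, hd, hmax⟩ := hex
  -- The denominator is the reversed recurrence polynomial, normalised by `u d` to have constant
  -- term 1.
  let Q : BigWitt K := ⟨PowerSeries.mk fun n => if n ≤ d then (u d)⁻¹ * u (d - n) else 0, by
    rw [← PowerSeries.coeff_zero_eq_constantCoeff_apply, PowerSeries.coeff_mk]
    simp [hd]⟩
  have hQ : ∀ n, Q.coeff n = if n ≤ d then (u d)⁻¹ * u (d - n) else 0 := fun n =>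
    PowerSeries.coeff_mk (R := K) n fun n => if n ≤ d then (u d)⁻¹ * u (d - n) else 0
  refine ⟨Q, fun k hk => by rw [hQ, if_neg (by omega)], fun k hk => ?_⟩
  -- The coefficient of `t^k` in the product of `Q` and `f` is, up to `u d`, the recurrence at `k -
  -- d`, which is at least `k₀` because `d < c`.
  have hk' := hu (k - d) (by omega)
  have hsub : Finset.range (d + 1) ⊆ Finset.range c := Finset.range_subset_range.mpr (by omega)
  rw [← Finset.sum_subset hsub fun j _ hj => by
    rw [hmax j (by simpa using hj), zero_mul]] at hk'
  rw [add_comm, coeff_add, Finset.Nat.sum_antidiagonal_eq_sum_range_succ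
    (fun i j => Q.coeff i * f.coeff j)]
  have hsub' : Finset.range (d + 1) ⊆ Finset.range (k + 1) :=
    Finset.range_subset_range.mpr (by omega)
  rw [← Finset.sum_subset hsub' fun j _ hj => by
    rw [hQ, if_neg (by simpa using hj), zero_mul], ← Finset.sum_range_reflect]
  rw [← mul_zero (u d)⁻¹, ← hk', Finset.mul_sum]
  refine Finset.sum_congr rfl fun j hj => ?_
  rw [Finset.mem_range] at hj
  rw [hQ, if_pos (by omega), mul_assoc]
  congr 3
  all_goals omega

end BigWitt

/-! ### The λ-homomorphism to the Witt ring, and rationality of Schur-finite elements. -/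

section LambdaSeries

variable {R : Type*} [CommRing R] [LambdaRing R] {A : Type*} [CommRing A]

/-- The series `∑ g(λ^n(x)) t^n`. -/
def lambdaSeries (g : R →+* A) (x : R) : BigWitt A :=
  ⟨PowerSeries.mk fun n => g (LambdaRing.lam n x), by
    rw [← PowerSeries.coeff_zero_eq_constantCoeff_apply, PowerSeries.coeff_mk,
      LambdaRing.lam_zero, map_one]⟩

theorem coeff_lambdaSeries (g : R →+* A) (x : R) (n : ℕ) :
    (lambdaSeries g x).coeff n = g (LambdaRing.lam n x) :=
  PowerSeries.coeff_mk (R := A) n fun n => g (LambdaRing.lam n x)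

theorem lambdaSeries_one (g : R →+* A) : lambdaSeries g 1 = 1 :=
  BigWitt.ext_coeff fun n => by
    rw [coeff_lambdaSeries, BigWitt.coeff_one]
    match n with
    | 0 => rw [LambdaRing.lam_zero, map_one, esymm_zero']
    | 1 => rw [LambdaRing.lam_one, map_one]; simp [Multiset.esymm, Multiset.powersetCard_one]
    | n + 2 => rw [LambdaRing.lam_of_one _ (by omega), map_zero, esymm_eq_zero _ _ (by simp)]

theorem lambdaSeries_add (g : R →+* A) (x y : R) :
    lambdaSeries g (x + y) = lambdaSeries g x + lambdaSeries g y :=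
  BigWitt.ext_coeff fun n => by
    simp [coeff_lambdaSeries, BigWitt.coeff_add, LambdaRing.lam_add]

theorem lambdaSeries_mul (g : R →+* A) (x y : R) :
    lambdaSeries g (x * y) = lambdaSeries g x * lambdaSeries g y :=
  BigWitt.ext_coeff fun n => by
    simp only [BigWitt.coeff_mul, funext (coeff_lambdaSeries g _), LambdaRing.lam_mul, map_mulEval]

theorem lambdaSeries_lam (g : R →+* A) (n : ℕ) (x : R) :
    lambdaSeries g (LambdaRing.lam n x) = LambdaRing.lam n (lambdaSeries g x) :=
  BigWitt.ext_coeff fun m => by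
    change _ = (BigWitt.lam n (lambdaSeries g x)).coeff m
    simp only [BigWitt.coeff_lam, funext (coeff_lambdaSeries g _), LambdaRing.lam_lam, map_lamEval]

/-- The homomorphism of `λ`-rings `R → W(A)`, `x ↦ ∑ g(λ^n(x)) t^n`. -/
def lambdaSeriesHom (g : R →+* A) : R →+* BigWitt A where
  toFun := lambdaSeries g
  map_one' := lambdaSeries_one g
  map_mul' := lambdaSeries_mul g
  map_zero' := by
    have h := lambdaSeries_add g 0 0
    rw [add_zero] at h
    exact left_eq_add.mp h
  map_add' := lambdaSeries_add g

/-- The order of quantifiers is the point: `m` and `n` are chosen before the field, so the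
decompositions at different primes have the same shape. -/
theorem IsSchurFinite.exists_lambdaSeries_eq {x : R} (hx : IsSchurFinite x) : ∃ m n : ℕ,
    ∀ {K : Type*} [Field K] [IsAlgClosed K] (g : R →+* K), ∃ (α : Fin m → K) (β : Fin n → K),
      lambdaSeries g x =
        ∑ a, BigWitt.ofMultiset {α a} - ∑ b, BigWitt.ofMultiset {β b} := by
  obtain ⟨c, hc⟩ := hx.exists_det_eq_zero
  -- The denominator has degree at most `c`; the numerator at most `k₀ + c` with `k₀ = c`, as the
  -- recurrence starts at `c`.
  refine ⟨c + c, c, fun {K} _ _ g => ?_⟩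
  obtain ⟨v, hv, hrec⟩ := exists_recurrence_of_det_eq_zero (lambdaSeries g x).coeff c c
    fun r hr hge => by
      have h := congrArg g (hc r hr hge)
      rw [RingHom.map_det, map_zero] at h
      rw [← h]
      congr 1
      ext i j
      simp [coeff_lambdaSeries]
  obtain ⟨Q, hQ, hP⟩ := BigWitt.exists_add_eq_of_recurrence _ hv hrec
  obtain ⟨s, hs, hsP⟩ := BigWitt.exists_ofMultiset_eq _ _ hP
  obtain ⟨t, ht, htQ⟩ := BigWitt.exists_ofMultiset_eq _ _ hQ
  obtain ⟨α, hα⟩ := BigWitt.exists_ofMultiset_eq_sum s hs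
  obtain ⟨β, hβ⟩ := BigWitt.exists_ofMultiset_eq_sum t ht
  refine ⟨α, β, ?_⟩
  rw [← hα, ← hβ, hsP, htQ, add_sub_cancel_right]

end LambdaSeries

/-! ### Assembly over the prime spectrum. -/

theorem mainTheorem6 {R : Type u} [CommRing R] [LambdaRing R] [IsReduced R] :
    ∃ (ι : Type u) (E : ι → Type u) (_ : ∀ i, Field (E i)) (_ : ∀ i, IsAlgClosed (E i))
      (φ : LambdaRingHom R (∀ i, BigWitt (E i))),
      Function.Injective φ.toRingHom ∧
      ∀ x : R, IsSchurFinite x →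
        ∃ (m n : ℕ) (ℓ : Fin m → ∀ i, BigWitt (E i)) (ℓ' : Fin n → ∀ i, BigWitt (E i)),
          (∀ a, IsLineElement (ℓ a)) ∧ (∀ b, IsLineElement (ℓ' b)) ∧
          φ.toRingHom x = ∑ a, ℓ a - ∑ b, ℓ' b := by
  let E : PrimeSpectrum R → Type u := fun p => AlgebraicClosure p.asIdeal.ResidueField
  let g : ∀ p, R →+* E p := fun p => algebraMap R (E p)
  have hker : ∀ p x, g p x = 0 → x ∈ p.asIdeal := fun p x hx => by
    rw [← Ideal.algebraMap_residueField_eq_zero]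
    apply (algebraMap p.asIdeal.ResidueField (E p)).injective
    rw [map_zero, ← hx]
    exact (IsScalarTower.algebraMap_apply R p.asIdeal.ResidueField (E p) x).symm
  refine ⟨PrimeSpectrum R, E, fun p => inferInstance, fun p => inferInstance,
    ⟨RingHom.pi fun p => lambdaSeriesHom (g p), fun n x =>
      funext fun p => lambdaSeries_lam (g p) n x⟩, ?_, fun x hx => ?_⟩
  · rw [injective_iff_map_eq_zero]
    intro x hx
    have hnil : x ∈ nilradical R := by
      rw [nilradical_eq_sInf, Submodule.mem_sInf]
      intro P hP
      refine hker ⟨P, hP⟩ x ?_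
      have h1 : lambdaSeries (g ⟨P, hP⟩) x = 0 := congrFun hx ⟨P, hP⟩
      -- The coefficient of `t` is `g(λ^1(x)) = g(x)`, while the zero of the Witt ring is the series
      -- `1`.
      have h2 := congrArg (fun f => f.coeff 1) h1
      simp only [coeff_lambdaSeries, LambdaRing.lam_one] at h2
      rw [h2, ← BigWitt.ofMultiset_zero, BigWitt.coeff_ofMultiset]
      exact esymm_eq_zero _ _ (by simp)
    exact (mem_nilradical.mp hnil).eq_zero
  · obtain ⟨m, n, h⟩ := hx.exists_lambdaSeries_eq
    -- Since `m` and `n` do not vary with `p`, the `a`-th factors at all primes form one element of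
    -- the product.
    choose α β hαβ using fun p => h (g p)
    refine ⟨m, n, fun a p => BigWitt.ofMultiset {α p a}, fun b p => BigWitt.ofMultiset {β p b},
      fun a k hk => funext fun p => BigWitt.isLineElement_ofMultiset_singleton _ k hk,
      fun b k hk => funext fun p => BigWitt.isLineElement_ofMultiset_singleton _ k hk, ?_⟩
    funext p
    rw [Pi.sub_apply, Finset.sum_apply, Finset.sum_apply]
    exact hαβ p
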